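/- Let $G$ be a finite simple bipartite graph without isolated vertices and with at least one vertex (hence at least one edge), with vertex set $V_G$ and edge set $E_G$, and let $K$ be any field. Let $K[V_G]=K[x_i : i\in V_G]$ and $K[E_G]=K[t_e : e\in E_G]$ be the standard graded polynomial rings, let $\theta\colon K[E_G]\to K[V_G]$ be the $K$-algebra homomorphism with $\theta(t_e)=x_ix_j$ for every edge $e=\{i,j\}$, and let $I(X_G)=\theta^{-1}\big((x_i^2-x_j^2 : i,j\in V_G)\big)$, a homogeneous ideal of $K[E_G]$. A \emph{join} of $G$ is a set $J\subseteq E_G$ such that $|J\cap E_C|\le |E_C|/2$ for every circuit (closed trail with at least one edge) $C$ of $G$, where $E_C$ is the set of edges of $C$; the \emph{maximum vertex join number} $\mu(G)$ is the maximum cardinality of a join of $G$. For a finitely generated graded $K[E_G]$-module $M\neq 0$ with graded Betti numbers $\beta_{ij}(M)=\dim_K \operatorname{Tor}_i(M,K)_j$, let $\operatorname{reg} M=\max\{j-i : \beta_{ij}(M)\ne 0\}$ be its Castelnuovo--Mumford regularity, with the convention that the zero ideal has regularity $1$ (so that $\operatorname{reg} I=\operatorname{reg} K[E_G]/I+1$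 for every proper homogeneous ideal $I$). Then $$\operatorname{reg} I(X_G)=\mu(G),\qquad\text{and equivalently}\qquad \operatorname{reg} K[E_G]/I(X_G)=\mu(G)-1 .$$ -/

import Mathlib

noncomputable section

namespace JoinRegularity

open MvPolynomial

/-! ### Koszul homology and graded Betti numbers

`R = K[x_v : v ∈ σ]` is the standard graded polynomial ring, `M` is an `R`-module with graded
pieces `ℳ d` (`d : ℕ`). The exterior power `⋀^i W` of the space `W` of linear forms (with basis
`x_v`) is the space of alternating `i`-forms on the dual space `σ → K`, so `⋀^i W ⊗ M` is the space
of alternating `i`-linear maps from `σ → K` to `M`. -/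

section Koszul

variable {σ K : Type*} [Fintype σ] [DecidableEq σ] [Field K]

/-- The term of homological degree `i` of the Koszul complex of `M` on the variables. -/
abbrev KoszulTerm (σ K M : Type*) [Field K] [AddCommGroup M] [Module K M] (i : ℕ) : Type _ :=
  (σ → K) [⋀^Fin i]→ₗ[K] M

variable {M : Type*} [AddCommGroup M] [Module K M] [Module (MvPolynomial σ K) M]
  [IsScalarTower K (MvPolynomial σ K) M]

variable (σ K M) in
/-- The Koszul differential `∂ : ⋀^(i+1) W ⊗ M → ⋀^i W ⊗ M`, the contraction with `∑ v, e_v ⊗ x_v`: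
`(∂ c) (w₁, …, wᵢ) = ∑ v, x_v • c (e_v, w₁, …, wᵢ)`. -/
def koszulD (i : ℕ) : KoszulTerm σ K M (i + 1) →ₗ[K] KoszulTerm σ K M i where
  toFun c := ∑ v : σ, (X v : MvPolynomial σ K) • c.curryLeft (Pi.single v 1)
  map_add' c c' := by simp [Finset.sum_add_distrib]
  map_smul' a c := by
    simp only [AlternatingMap.curryLeft_smul, LinearMap.smul_apply, RingHom.id_apply,
      Finset.smul_sum]
    exact Finset.sum_congr rfl fun v _ => smul_comm _ _ _

theorem koszulD_apply (i : ℕ) (c : KoszulTerm σ K M (i + 1)) (w : Fin i → σ → K) :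
    koszulD σ K M i c w =
      ∑ v : σ, (X v : MvPolynomial σ K) • c (Matrix.vecCons (Pi.single v 1) w) := by
  change (∑ v : σ, (X v : MvPolynomial σ K) • c.curryLeft (Pi.single v 1)) w = _
  exact map_sum (⟨⟨fun f => f w, rfl⟩, fun _ _ => rfl⟩ : KoszulTerm σ K M i →+ M) _ _

theorem koszulD_koszulD (i : ℕ) (c : KoszulTerm σ K M (i + 1 + 1)) :
    koszulD σ K M i (koszulD σ K M (i + 1) c) = 0 := by
  ext w
  simp only [koszulD_apply, Finset.smul_sum, AlternatingMap.zero_apply]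
  rw [← Finset.sum_product']
  refine Finset.sum_involution (fun p _ => p.swap) ?_ ?_ (by simp) (by simp)
  · rintro ⟨a, b⟩ -
    have h := c.map_swap
      (Matrix.vecCons (Pi.single b 1) (Matrix.vecCons (Pi.single a 1) w)) (i := 0) (j := 1) (by simp)
    have h' : (Matrix.vecCons (Pi.single b 1) (Matrix.vecCons (Pi.single a 1) w)) ∘
        (Equiv.swap (0 : Fin (i + 1 + 1)) 1) =
        Matrix.vecCons (Pi.single a (1 : K)) (Matrix.vecCons (Pi.single b 1) w) := by
      funext k
      refine Fin.cases ?_ (fun k => Fin.cases ?_ (fun k => ?_) k) k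
      · simp
      · simp
      · rw [Function.comp_apply, Equiv.swap_apply_of_ne_of_ne]
        · rfl
        · exact Fin.succ_ne_zero _
        · intro hk
          exact Fin.succ_ne_zero k (Fin.succ_injective _ hk)
    rw [h'] at h
    simp only [Prod.swap]
    rw [h, smul_neg, smul_neg, smul_smul, smul_smul, mul_comm, add_neg_cancel]
  · rintro ⟨a, b⟩ - hne hab
    simp only [Prod.swap_prod_mk, Prod.mk.injEq] at hab
    obtain ⟨rfl, -⟩ := hab
    refine hne ?_
    dsimp only
    rw [c.map_eq_zero_of_eq _ (i := 0) (j := 1) (by simp) (by simp), smul_zero, smul_zero]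

variable (σ K M) in
/-- The cycles of homological degree `i` of the Koszul complex. -/
def koszulCycles : (i : ℕ) → Submodule K (KoszulTerm σ K M i)
  | 0 => ⊤
  | i + 1 => LinearMap.ker (koszulD σ K M i)

variable (σ K M) in
/-- The boundaries of homological degree `i` of the Koszul complex. -/
def koszulBoundaries (i : ℕ) : Submodule K (KoszulTerm σ K M i) :=
  LinearMap.range (koszulD σ K M i)

variable (σ) in
/-- The part of internal degree `j` of `⋀^i W ⊗ M`: since `⋀^i W` sits in degree `i`, it is
`⋀^i W ⊗ M_(j-i)`, which is zero for `j < i`. -/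
def koszulPiece (ℳ : ℕ → Submodule K M) (i j : ℕ) : Submodule K (KoszulTerm σ K M i) where
  carrier := {c | ∀ w, c w ∈ if i ≤ j then ℳ (j - i) else ⊥}
  add_mem' hc hc' w := Submodule.add_mem _ (hc w) (hc' w)
  zero_mem' _ := Submodule.zero_mem _
  smul_mem' a _ hc w := Submodule.smul_mem _ a (hc w)

variable (σ) in
/-- The graded Betti number `β_{i,j}(M) = dim_K Tor_i^R(K, M)_j`, where `Tor` is computed from the
Koszul resolution of `K`: the dimension of the part of internal degree `j` of the `i`-th homology
of the Koszul complex of `M`. -/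
def gradedBetti (ℳ : ℕ → Submodule K M) (i j : ℕ) : Cardinal :=
  Module.rank K
    (↥(koszulCycles σ K M i ⊓ koszulPiece σ ℳ i j) ⧸
      (koszulBoundaries σ K M i).comap (koszulCycles σ K M i ⊓ koszulPiece σ ℳ i j).subtype)

variable (σ) in
/-- `r` is the Castelnuovo–Mumford regularity of `M`: the maximum of `j - i` over all `i`, `j` with
`β_{i,j}(M) ≠ 0`. -/
def HasRegularity (ℳ : ℕ → Submodule K M) (r : ℤ) : Prop :=
  IsGreatest {d : ℤ | ∃ i j : ℕ, d = (j : ℤ) - (i : ℤ) ∧ gradedBetti σ ℳ i j ≠ 0} r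

/-- The degree `d` part of a homogeneous ideal `I` of `K[x_v : v ∈ σ]`. -/
def idealPiece (I : Ideal (MvPolynomial σ K)) (d : ℕ) : Submodule K I :=
  (homogeneousSubmodule σ K d).comap (I.subtype.restrictScalars K)

/-- The degree `d` part of `K[x_v : v ∈ σ] ⧸ I` for a homogeneous ideal `I`. -/
def quotientPiece (I : Ideal (MvPolynomial σ K)) (d : ℕ) :
    Submodule K (MvPolynomial σ K ⧸ I) :=
  (homogeneousSubmodule σ K d).map (Ideal.Quotient.mkₐ K I).toLinearMap

/-- `r` is the Castelnuovo–Mumford regularity of the homogeneous ideal `I`: that of the graded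
module `I` if `I ≠ 0`, and `1` if `I = 0` (the usual convention, for which
`reg I = reg (R ⧸ I) + 1` for all proper homogeneous ideals). -/
def IdealHasRegularity (I : Ideal (MvPolynomial σ K)) (r : ℤ) : Prop :=
  (I ≠ ⊥ ∧ HasRegularity σ (idealPiece I) r) ∨ (I = ⊥ ∧ r = 1)

end Koszul

section Graph

variable {V : Type*} (K : Type*) [Field K] (G : SimpleGraph V)

/-- `θ : K[E_G] → K[V_G]`, `t_e ↦ x_i x_j` for `e = {i, j}`. -/
def theta : MvPolynomial G.edgeSet K →ₐ[K] MvPolynomial V K :=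
  aeval fun e => Sym2.lift ⟨fun i j => X i * X j, fun i j => mul_comm (X i) (X j)⟩ (e : Sym2 V)

/-- The ideal `I(X_G) = θ⁻¹ (x_i² - x_j² : i, j ∈ V_G)` of `K[E_G]`. -/
def graphIdeal : Ideal (MvPolynomial G.edgeSet K) :=
  (Ideal.span {f : MvPolynomial V K | ∃ i j : V, f = X i ^ 2 - X j ^ 2}).comap (theta K G)

/-- A join of `G`: a set `J` of edges with `|J ∩ E_C| ≤ |E_C| / 2` for every circuit `C` (closed
trail with at least one edge) of `G`. -/
def IsJoin (J : Set (Sym2 V)) : Prop :=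
  J ⊆ G.edgeSet ∧ ∀ (v : V) (C : G.Walk v v), C.IsCircuit →
    2 * (J ∩ C.edgeSet).ncard ≤ C.edgeSet.ncard

/-- The maximum vertex join number `μ(G)`: the maximum cardinality of a join of `G`. -/
def maxVertexJoinNumber : ℕ :=
  sSup {n : ℕ | ∃ J : Set (Sym2 V), IsJoin G J ∧ J.ncard = n}

end Graph

end JoinRegularity

end

set_option linter.unusedSectionVars false

/-! Modulo the differences x_i² - x_j², a monomial is determined by its degree and its exponents mod
2. Hence I = I(X_G) is the kernel of the monomial map sending t^a to (2|a|, parities of the vertex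
degrees of the edge multiset a) in a monoid algebra (`mem_graphIdeal_iff`). Call two multisets
equivalent if their sizes and parities agree. Translations are injective, so every t_e is a
nonzerodivisor on R/I, where R = K[E_G]. The quotient R/(I, t_e) lives in degree d exactly when some
multiset of d edges is not equivalent to one containing e.

Combinatorially, joins are the edge sets of minimum size in their parity class
(`isJoin_iff_forall_card_le`), so μ(G) is the largest of these minima. In a bipartite graph parities
fix the size mod 2, and squares t_e² pad a multiset without changing parities. Comparing a with a +
e then shows that the top degree of R/(I, t_e) is μ(G) - 1 (`exists_edgeParity_add_eq`,
`exists_forall_edgeParity_add_ne`).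

Algebraically, when x_e is a nonzerodivisor on R/I, the regularity of R/I is this top degree D
(`regularity_of_mulVar_injective`). Koszul homology is killed by x_e, which gives vanishing beyond
D; a socle element of degree D gives a nonzero class. Exactness of the Koszul complex of R transfers
the result to I with a shift by one. -/

noncomputable section

namespace JoinRegularity

open MvPolynomial

/-! ### Koszul complexes: naturality and exterior multiplication -/

section Koszul

variable {σ K : Type*} [Fintype σ] [DecidableEq σ] [Field K]
  {M : Type*} [AddCommGroup M] [Module K M] [Module (MvPolynomial σ K) M]
  [IsScalarTower K (MvPolynomial σ K) M]
  {N : Type*} [AddCommGroup N] [Module K N] [Module (MvPolynomial σ K) N]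
  [IsScalarTower K (MvPolynomial σ K) N]

theorem gradedBetti_eq_zero_iff (ℳ : ℕ → Submodule K M) (i j : ℕ) :
    gradedBetti σ ℳ i j = 0 ↔
      ∀ c ∈ koszulCycles σ K M i, c ∈ koszulPiece σ ℳ i j → c ∈ koszulBoundaries σ K M i := by
  rw [gradedBetti, rank_zero_iff, Submodule.Quotient.subsingleton_iff,
    Submodule.comap_subtype_eq_top, SetLike.le_def]
  simp only [Submodule.mem_inf, and_imp]

theorem mem_koszulPiece {ℳ : ℕ → Submodule K M} {i j : ℕ} (hij : i ≤ j)
    {c : KoszulTerm σ K M i} : c ∈ koszulPiece σ ℳ i j ↔ ∀ w, c w ∈ ℳ (j - i) := by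
  change (∀ w, c w ∈ if i ≤ j then ℳ (j - i) else ⊥) ↔ _
  rw [if_pos hij]

/-- The Koszul differential is natural in the module. -/
theorem koszulD_compAlternatingMap (f : M →ₗ[K] N)
    (hf : ∀ (v : σ) (m : M), f ((X v : MvPolynomial σ K) • m) = (X v : MvPolynomial σ K) • f m)
    (i : ℕ) (c : KoszulTerm σ K M (i + 1)) :
    koszulD σ K N i (f.compAlternatingMap c) = f.compAlternatingMap (koszulD σ K M i c) := by
  ext w
  simp [koszulD_apply, hf]

variable (σ K M) in
/-- Multiplication by a variable as a `K`-linear map. -/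
def mulVar (v : σ) : M →ₗ[K] M :=
  Algebra.lsmul K K M (X v : MvPolynomial σ K)

@[simp]
theorem mulVar_apply (v : σ) (m : M) : mulVar σ K M v m = (X v : MvPolynomial σ K) • m := rfl

theorem koszulD_mulVar (v : σ) (i : ℕ) (c : KoszulTerm σ K M (i + 1)) :
    koszulD σ K M i ((mulVar σ K M v).compAlternatingMap c) =
      (mulVar σ K M v).compAlternatingMap (koszulD σ K M i c) :=
  koszulD_compAlternatingMap _ (fun _ _ => smul_comm _ _ _) i c

/-- The linear map `w ↦ w e • c` on the dual space of the space of linear forms. -/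
def coordSmul (e : σ) {i : ℕ} (c : KoszulTerm σ K M i) : (σ → K) →ₗ[K] KoszulTerm σ K M i :=
  (LinearMap.proj e : (σ → K) →ₗ[K] K).smulRight c

/-- Left exterior multiplication by the variable `e` on the Koszul complex. -/
def koszulWedge (e : σ) {i : ℕ} (c : KoszulTerm σ K M i) : KoszulTerm σ K M (i + 1) :=
  AlternatingMap.alternatizeUncurryFin (coordSmul e c)

theorem koszulWedge_apply (e : σ) {i : ℕ} (c : KoszulTerm σ K M i) (w : Fin (i + 1) → σ → K) :
    koszulWedge e c w = ∑ k : Fin (i + 1), (-1 : ℤ) ^ (k : ℕ) • w k e • c (k.removeNth w) := by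
  simp [koszulWedge, AlternatingMap.alternatizeUncurryFin_apply, coordSmul]

/-- Contraction by a covector is an antiderivation for the wedge product; this is the source of the
homotopy formula for `koszulWedge`. -/
theorem koszulWedge_vecCons (e : σ) {i : ℕ} (c : KoszulTerm σ K M (i + 1)) (x : σ → K)
    (w : Fin (i + 1) → σ → K) :
    koszulWedge e c (Matrix.vecCons x w) = x e • c w - koszulWedge e (c.curryLeft x) w := by
  rw [koszulWedge_apply, Fin.sum_univ_succ, koszulWedge_apply, sub_eq_add_neg,
    ← Finset.sum_neg_distrib]
  congr 1
  · simp [Matrix.vecCons]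
  · refine Finset.sum_congr rfl fun k _ => ?_
    have : (k.succ.removeNth (Matrix.vecCons x w) : Fin (i + 1) → σ → K) =
        Matrix.vecCons x (k.removeNth w) := by
      funext j
      refine Fin.cases ?_ (fun j => ?_) j <;> simp [Matrix.vecCons, Fin.removeNth]
    rw [this]
    simp [pow_succ]

theorem koszulD_wedge_zero (e : σ) (c : KoszulTerm σ K M 0) :
    koszulD σ K M 0 (koszulWedge e c) = (mulVar σ K M e).compAlternatingMap c := by
  ext w
  simp only [koszulD_apply, koszulWedge_apply]
  rw [Finset.sum_eq_single e]
  · simp [Subsingleton.elim _ w]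
  · intro b _ hb
    simp [hb.symm]
  · simp

/-- Exterior multiplication by `e` is a homotopy from multiplication by `x_e` to zero. -/
theorem koszulD_wedge (e : σ) {i : ℕ} (c : KoszulTerm σ K M (i + 1)) :
    koszulD σ K M (i + 1) (koszulWedge e c) =
      (mulVar σ K M e).compAlternatingMap c - koszulWedge e (koszulD σ K M i c) := by
  ext w
  simp only [koszulD_apply, koszulWedge_vecCons, smul_sub, Finset.sum_sub_distrib,
    AlternatingMap.sub_apply]
  congr 1
  · rw [Finset.sum_eq_single e]
    · simp
    · intro b _ hb
      simp [hb.symm]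
    · simp
  · simp only [koszulWedge_apply, koszulD_apply, Finset.smul_sum]
    rw [Finset.sum_comm]
    refine Finset.sum_congr rfl fun k _ => Finset.sum_congr rfl fun v _ => ?_
    rw [smul_comm, smul_comm (X v : MvPolynomial σ K)]
    rfl

end Koszul

/-! ### Betti numbers of a module with a nonzerodivisor variable -/

section Koszul

variable {σ K : Type*} [Fintype σ] [DecidableEq σ] [Field K]
  {M : Type*} [AddCommGroup M] [Module K M] [Module (MvPolynomial σ K) M]
  [IsScalarTower K (MvPolynomial σ K) M]

omit [Fintype σ] [DecidableEq σ] [Module (MvPolynomial σ K) M]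
  [IsScalarTower K (MvPolynomial σ K) M] in
/-- A chain with values in the image of a subspace `P` lifts to a chain with values in `P`. -/
theorem exists_compAlternatingMap_eq {N : Type*} [AddCommGroup N] [Module K N] (f : M →ₗ[K] N)
    (P : Submodule K M) {i : ℕ} (c : KoszulTerm σ K N i) (hc : ∀ w, ∃ m ∈ P, f m = c w) :
    ∃ c' : KoszulTerm σ K M i, (∀ w, c' w ∈ P) ∧ f.compAlternatingMap c' = c := by
  -- Over a field, f restricted to P has a linear section on its image, which extends to all of N;
  -- composing with it keeps the chain alternating.
  obtain ⟨r, hr⟩ := LinearMap.exists_rightInverse_of_surjective _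
    (LinearMap.range_rangeRestrict (f ∘ₗ P.subtype))
  obtain ⟨g, hg⟩ := LinearMap.exists_extend r
  refine ⟨(P.subtype ∘ₗ g).compAlternatingMap c, fun w => (g (c w)).2, ?_⟩
  ext w
  obtain ⟨m, hm, hmw⟩ := hc w
  have h1 := LinearMap.congr_fun hg ⟨c w, ⟨⟨m, hm⟩, hmw⟩⟩
  have h2 := congrArg Subtype.val (LinearMap.congr_fun hr ⟨c w, ⟨⟨m, hm⟩, hmw⟩⟩)
  simp only [LinearMap.comp_apply, Submodule.subtype_apply] at h1
  refine Eq.trans ?_ h2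
  exact congrArg (fun x : P => f x) h1

theorem mulVar_comp_injective {e : σ} (hinj : Function.Injective (mulVar σ K M e)) {i : ℕ}
    {c c' : KoszulTerm σ K M i}
    (h : (mulVar σ K M e).compAlternatingMap c = (mulVar σ K M e).compAlternatingMap c') :
    c = c' := by
  ext w
  exact hinj (congrArg (fun f => f w) h)

theorem mem_koszulCycles_of_mulVar_comp {e : σ} (hinj : Function.Injective (mulVar σ K M e))
    {i : ℕ} {c : KoszulTerm σ K M i}
    (h : (mulVar σ K M e).compAlternatingMap c ∈ koszulCycles σ K M i) :
    c ∈ koszulCycles σ K M i := by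
  cases i with
  | zero => exact Submodule.mem_top
  | succ i =>
    refine mulVar_comp_injective hinj ?_
    rw [← koszulD_mulVar]
    change koszulD σ K M i _ = 0 at h
    rw [h]
    ext w
    simp

/-- Multiplication by a variable annihilates Koszul homology. -/
theorem mulVar_comp_mem_koszulBoundaries (e : σ) {i : ℕ} {c : KoszulTerm σ K M i}
    (hc : c ∈ koszulCycles σ K M i) :
    (mulVar σ K M e).compAlternatingMap c ∈ koszulBoundaries σ K M i := by
  refine ⟨koszulWedge e c, ?_⟩
  cases i with
  | zero => exact koszulD_wedge_zero e c
  | succ i =>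
    change koszulD σ K M i c = 0 at hc
    rw [koszulD_wedge, hc]
    ext w
    simp [koszulWedge_apply]

/-- Beyond degree D every cycle is x_e times a chain, which is again a cycle by injectivity, and x_e
times a cycle is a boundary. -/
theorem gradedBetti_eq_zero_of_lt {ℳ : ℕ → Submodule K M} {e : σ}
    (hinj : Function.Injective (mulVar σ K M e)) {D : ℕ}
    (hgen : ∀ d, D ≤ d → ∀ m ∈ ℳ (d + 1), ∃ m' ∈ ℳ d, mulVar σ K M e m' = m)
    {i j : ℕ} (hij : D + i < j) : gradedBetti σ ℳ i j = 0 := by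
  rw [gradedBetti_eq_zero_iff]
  intro c hc hcp
  rw [mem_koszulPiece (by omega)] at hcp
  obtain ⟨c', -, rfl⟩ := exists_compAlternatingMap_eq (mulVar σ K M e) (ℳ (j - i - 1)) c fun w =>
    hgen (j - i - 1) (by omega) (c w)
      (by rw [show j - i - 1 + 1 = j - i by omega]; exact hcp w)
  exact mulVar_comp_mem_koszulBoundaries e (mem_koszulCycles_of_mulVar_comp hinj hc)

/-- The value of the differential of a form of top degree. -/
theorem koszulD_top_apply {m : ℕ} (ε : Fin (m + 1) ≃ σ) (c : KoszulTerm σ K M (m + 1)) :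
    koszulD σ K M m c (fun k => Pi.single (ε k.succ) 1) =
      mulVar σ K M (ε 0) (c fun k => Pi.single (ε k) 1) := by
  rw [koszulD_apply, Finset.sum_eq_single (ε 0)]
  · rw [mulVar_apply]
    congr 2
    funext k
    refine Fin.cases ?_ (fun k => ?_) k <;> simp
  · intro v _ hv
    obtain ⟨k, rfl⟩ := ε.surjective v
    obtain ⟨k, rfl⟩ := Fin.exists_succ_eq.2 (fun h => hv (by rw [h]) : k ≠ 0)
    rw [c.map_eq_zero_of_eq _ (i := 0) (j := k.succ) (by simp) (Fin.succ_ne_zero k).symm,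
      smul_zero]
  · simp

/-- A socle element of `M / x_e M` gives a Koszul homology class one step below the top. -/
theorem exists_koszulCycle_notMem_boundaries {ℳ : ℕ → Submodule K M}
    (hmul : ∀ d v, ∀ m ∈ ℳ d, mulVar σ K M v m ∈ ℳ (d + 1)) {e : σ}
    (hinj : Function.Injective (mulVar σ K M e)) {D : ℕ}
    (hgen : ∀ m ∈ ℳ (D + 1), ∃ m' ∈ ℳ D, mulVar σ K M e m' = m)
    {f : M} (hf : f ∈ ℳ D) (hfe : ∀ m, mulVar σ K M e m ≠ f) {n : ℕ}
    (hn : Fintype.card σ = n + 1) :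
    ∃ c ∈ koszulCycles σ K M n, (∀ w, c w ∈ ℳ D) ∧ c ∉ koszulBoundaries σ K M n := by
  -- The variable e is numbered 0, since `koszulD_top_apply` extracts the factor x_(ε 0).
  obtain ⟨ε, hε⟩ : ∃ ε : Fin (n + 1) ≃ σ, ε 0 = e := by
    let ε₀ := (Fintype.equivFinOfCardEq hn).symm
    exact ⟨(Equiv.swap 0 (ε₀.symm e)).trans ε₀, by simp⟩
  subst hε
  let b : Module.Basis (Fin (n + 1)) K (σ → K) := (Pi.basisFun K σ).reindex ε.symm
  have hb : ∀ k, b k = Pi.single (ε k) 1 := fun k => by simp [b]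
  -- Ω is f times the volume form. Modulo x_e it is a cycle of top degree; the class sought is its
  -- image under the connecting map, namely ∂Ω divided by x_e.
  let Ω : KoszulTerm σ K M (n + 1) := (LinearMap.toSpanSingleton K M f).compAlternatingMap b.det
  have hΩ : Ω (fun k => Pi.single (ε k) 1) = f := by
    have : (fun k => Pi.single (ε k) 1) = (b : Fin (n + 1) → σ → K) := funext fun k => (hb k).symm
    rw [this]
    simp [Ω, b.det_self]
  have hΩD : ∀ w, Ω w ∈ ℳ D := fun w => by
    simpa [Ω] using Submodule.smul_mem _ _ hf
  have hval : ∀ w, koszulD σ K M n Ω w ∈ ℳ (D + 1) := fun w => by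
    rw [koszulD_apply]
    exact Submodule.sum_mem _ fun v _ => hmul D v _ (hΩD _)
  obtain ⟨c, hcD, hc⟩ := exists_compAlternatingMap_eq (mulVar σ K M (ε 0)) (ℳ D)
    (koszulD σ K M n Ω) fun w => hgen _ (hval w)
  refine ⟨c, mem_koszulCycles_of_mulVar_comp hinj ?_, hcD, ?_⟩
  · rw [hc]
    cases n with
    | zero => exact Submodule.mem_top
    | succ n => exact koszulD_koszulD n Ω
  · rintro ⟨a, ha⟩
    rw [← ha, ← koszulD_mulVar] at hc
    -- If ∂a = c then ∂(x_e a) = ∂Ω; evaluating away from e gives x_e · (x_e a) = x_e · f, so f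
    -- would be divisible by x_e.
    have h := congrArg (fun g => g fun k => Pi.single (ε k.succ) 1) hc
    rw [koszulD_top_apply, koszulD_top_apply, hΩ] at h
    exact hfe _ (hinj h)

end Koszul

/-! ### Exactness of the Koszul complex of the polynomial ring -/

section Koszul

variable {σ K : Type*} [Fintype σ] [DecidableEq σ] [Field K]

variable (K) in
/-- The `K`-linear map dividing by a variable and dropping the monomials it does not divide. -/
def divVar (v : σ) : MvPolynomial σ K →ₗ[K] MvPolynomial σ K where
  toFun p := p.divMonomial (Finsupp.single v 1)
  map_add' p q := add_divMonomial p q _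
  map_smul' a p := by
    ext
    simp [coeff_divMonomial]

theorem coeff_divVar (v : σ) (p : MvPolynomial σ K) (a : σ →₀ ℕ) :
    coeff a (divVar K v p) = coeff (Finsupp.single v 1 + a) p :=
  coeff_divMonomial _ _ _

theorem divVar_X_mul_self (v : σ) (p : MvPolynomial σ K) : divVar K v (X v * p) = p :=
  X_mul_divMonomial v p

theorem divVar_X_mul_of_ne {u v : σ} (h : u ≠ v) (p : MvPolynomial σ K) :
    divVar K v (X u * p) = X u * divVar K v p := by
  ext a
  rw [coeff_divVar, coeff_X_mul', coeff_X_mul', coeff_divVar]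
  have h1 : u ∈ (Finsupp.single v 1 + a).support ↔ u ∈ a.support := by
    simp [h]
  by_cases ha : u ∈ a.support
  · rw [if_pos (h1.2 ha), if_pos ha, add_tsub_assoc_of_le]
    rw [Finsupp.single_le_iff]
    exact Nat.one_le_iff_ne_zero.2 (Finsupp.mem_support_iff.1 ha)
  · rw [if_neg (h1.not.2 ha), if_neg ha]

theorem divVar_comm (u v : σ) (p : MvPolynomial σ K) :
    divVar K u (divVar K v p) = divVar K v (divVar K u p) := by
  ext a
  simp only [coeff_divVar]
  rw [add_left_comm]

variable (K) in
/-- The `K`-linear map dropping the monomials divisible by a variable. -/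
def modVar (v : σ) : MvPolynomial σ K →ₗ[K] MvPolynomial σ K :=
  LinearMap.id - mulVar σ K (MvPolynomial σ K) v ∘ₗ divVar K v

theorem modVar_apply (v : σ) (p : MvPolynomial σ K) :
    modVar K v p = p - X v * divVar K v p := rfl

theorem divVar_modVar_self (v : σ) (p : MvPolynomial σ K) : divVar K v (modVar K v p) = 0 := by
  rw [modVar_apply, map_sub, divVar_X_mul_self, sub_self]

theorem divVar_modVar_of_eq_zero {u v : σ} {p : MvPolynomial σ K} (hp : divVar K u p = 0) :
    divVar K u (modVar K v p) = 0 := by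
  by_cases h : v = u
  · rw [h, divVar_modVar_self]
  · rw [modVar_apply, map_sub, divVar_X_mul_of_ne h, divVar_comm, hp]
    simp

/-- Division by x_v commutes with multiplication by the other variables. For x_v itself the two
orders of composition differ by the remainder `modVar`, so only the e_v component contributes a
defect. -/
theorem koszulD_divVar (v : σ) (i : ℕ) (c : KoszulTerm σ K (MvPolynomial σ K) (i + 1)) :
    koszulD σ K _ i ((divVar K v).compAlternatingMap c) =
      (divVar K v).compAlternatingMap (koszulD σ K _ i c) -
        (modVar K v).compAlternatingMap (c.curryLeft (Pi.single v 1)) := by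
  ext1 w
  simp only [koszulD_apply, LinearMap.compAlternatingMap_apply, AlternatingMap.sub_apply, map_sum,
    AlternatingMap.curryLeft_apply_apply, smul_eq_mul]
  rw [eq_sub_iff_add_eq, ← Finset.add_sum_erase _ _ (Finset.mem_univ v),
    ← Finset.add_sum_erase _ _ (Finset.mem_univ v), divVar_X_mul_self, modVar_apply,
    Finset.sum_congr rfl fun u hu => divVar_X_mul_of_ne (Finset.ne_of_mem_erase hu) _]
  ring

/-- Exterior multiplication commutes with coefficient maps. -/
theorem koszulWedge_compAlternatingMap {M N : Type*} [AddCommGroup M] [Module K M]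
    [AddCommGroup N] [Module K N] (f : M →ₗ[K] N) (v : σ) {i : ℕ} (c : KoszulTerm σ K M i) :
    koszulWedge v (f.compAlternatingMap c) = f.compAlternatingMap (koszulWedge v c) := by
  ext w
  simp only [koszulWedge, LinearMap.compAlternatingMap_apply,
    AlternatingMap.alternatizeUncurryFin_apply, map_sum, map_zsmul]
  simp [coordSmul]

theorem curryLeft_curryLeft_eq_zero {M : Type*} [AddCommGroup M] [Module K M] {i : ℕ}
    {c : KoszulTerm σ K M (i + 1 + 1)} {x : σ → K} (hx : c.curryLeft x = 0) (y : σ → K) :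
    (c.curryLeft y).curryLeft x = 0 := by
  ext w
  have h := c.map_swap (Matrix.vecCons x (Matrix.vecCons y w)) (i := 0) (j := 1) (by simp)
  have h' : (Matrix.vecCons x (Matrix.vecCons y w)) ∘ (Equiv.swap (0 : Fin (i + 1 + 1)) 1) =
      Matrix.vecCons y (Matrix.vecCons x w) := by
    funext k
    refine Fin.cases ?_ (fun k => Fin.cases ?_ (fun k => ?_) k) k
    · simp
    · simp
    · rw [Function.comp_apply, Equiv.swap_apply_of_ne_of_ne]
      · rfl
      · exact Fin.succ_ne_zero _
      · intro hk
        exact Fin.succ_ne_zero k (Fin.succ_injective _ hk)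
  rw [h'] at h
  have h2 := congrArg (fun g => g (Matrix.vecCons y w)) hx
  simp only [AlternatingMap.curryLeft_apply_apply, AlternatingMap.zero_apply] at h2 ⊢
  rw [h, h2, neg_zero]

/-- The projection of a Koszul chain to the part not involving the variable `v`. -/
def koszulDrop (v : σ) : {i : ℕ} → KoszulTerm σ K (MvPolynomial σ K) i →
    KoszulTerm σ K (MvPolynomial σ K) i
  | 0, c => (modVar K v).compAlternatingMap c
  | _ + 1, c => (modVar K v).compAlternatingMap
      (c - koszulWedge v (c.curryLeft (Pi.single v 1)))

/-- The map e_v ∧ (c / x_v) is a homotopy that eliminates the variable v, both from the coefficients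
and from the exterior part, at the cost of a boundary. -/
theorem sub_koszulDrop_eq (v : σ) {i : ℕ} {c : KoszulTerm σ K (MvPolynomial σ K) i}
    (hc : c ∈ koszulCycles σ K _ i) :
    c - koszulDrop v c = koszulD σ K _ i (koszulWedge v ((divVar K v).compAlternatingMap c)) := by
  cases i with
  | zero =>
    rw [koszulD_wedge_zero]
    ext1 w
    simp [koszulDrop, modVar_apply]
  | succ i =>
    change koszulD σ K _ i c = 0 at hc
    rw [koszulD_wedge, koszulD_divVar, hc]
    have h0 : ((divVar K v).compAlternatingMap (0 : KoszulTerm σ K (MvPolynomial σ K) i)) -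
        (modVar K v).compAlternatingMap (c.curryLeft (Pi.single v 1)) =
        (-modVar K v).compAlternatingMap (c.curryLeft (Pi.single v 1)) := by
      ext1 w
      simp
    rw [h0, koszulWedge_compAlternatingMap]
    ext1 w
    simp only [koszulDrop, AlternatingMap.sub_apply, LinearMap.compAlternatingMap_apply, map_sub,
      LinearMap.neg_apply, modVar_apply (p := c w), mulVar_apply, smul_eq_mul]
    ring

theorem divVar_koszulDrop_self (v : σ) {i : ℕ} (c : KoszulTerm σ K (MvPolynomial σ K) i)
    (w : Fin i → σ → K) : divVar K v (koszulDrop v c w) = 0 := by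
  cases i <;> exact divVar_modVar_self _ _

theorem divVar_koszulDrop {u : σ} (v : σ) {i : ℕ} {c : KoszulTerm σ K (MvPolynomial σ K) i}
    (hc : ∀ w, divVar K u (c w) = 0) (w : Fin i → σ → K) :
    divVar K u (koszulDrop v c w) = 0 := by
  cases i with
  | zero => exact divVar_modVar_of_eq_zero (hc _)
  | succ i =>
    refine divVar_modVar_of_eq_zero ?_
    change divVar K u (c w - koszulWedge v (c.curryLeft (Pi.single v 1)) w) = 0
    rw [map_sub, hc, koszulWedge_apply, map_sum, zero_sub,
      neg_eq_zero]
    refine Finset.sum_eq_zero fun k _ => ?_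
    rw [map_zsmul, map_smul, AlternatingMap.curryLeft_apply_apply, hc, smul_zero, smul_zero]

theorem curryLeft_koszulDrop_self (v : σ) {i : ℕ}
    (c : KoszulTerm σ K (MvPolynomial σ K) (i + 1)) :
    (koszulDrop v c).curryLeft (Pi.single v 1) = 0 := by
  ext1 w
  change modVar K v (c (Matrix.vecCons _ w) -
    koszulWedge v (c.curryLeft (Pi.single v 1)) (Matrix.vecCons _ w)) = 0
  cases i with
  | zero => simp [koszulWedge_apply, Subsingleton.elim _ w]
  | succ i =>
    rw [koszulWedge_vecCons]
    simp [koszulWedge_apply]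

theorem curryLeft_koszulDrop {u : σ} (v : σ) {i : ℕ}
    {c : KoszulTerm σ K (MvPolynomial σ K) (i + 1)} (hc : c.curryLeft (Pi.single u 1) = 0) :
    (koszulDrop v c).curryLeft (Pi.single u 1) = 0 := by
  by_cases huv : u = v
  · rw [huv, curryLeft_koszulDrop_self]
  ext1 w
  change modVar K v (c (Matrix.vecCons _ w) -
    koszulWedge v (c.curryLeft (Pi.single v 1)) (Matrix.vecCons _ w)) = 0
  have h1 : c (Matrix.vecCons (Pi.single u 1) w) = 0 := congrArg (fun g => g w) hc
  rw [h1]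
  cases i with
  | zero => simp [koszulWedge_apply, Ne.symm huv]
  | succ i =>
    rw [koszulWedge_vecCons, curryLeft_curryLeft_eq_zero hc]
    simp [koszulWedge_apply, Ne.symm huv]

/-- S is the set of variables still allowed to occur; each induction step drops one of them modulo a
boundary. With none left only constants in homological degree 0 could survive, and the last
hypothesis excludes them. The transport along i = k + 1 is there because contraction needs positive
degree. -/
theorem koszulCycle_mem_boundaries_aux (S : Finset σ) : ∀ {i : ℕ}
    (c : KoszulTerm σ K (MvPolynomial σ K) i), c ∈ koszulCycles σ K _ i →
    (∀ v ∉ S, ∀ w, divVar K v (c w) = 0) →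
    (∀ v ∉ S, ∀ k (h : i = k + 1), (h ▸ c).curryLeft (Pi.single v 1) = 0) →
    (i = 0 → ∀ w, coeff 0 (c w) = 0) → c ∈ koszulBoundaries σ K _ i := by
  induction S using Finset.induction_on with
  | empty =>
    intro i c _ hdiv hcurry h0
    suffices c = 0 by
      rw [this]
      exact Submodule.zero_mem _
    cases i with
    | zero =>
      ext w a
      by_cases ha : a = 0
      · rw [ha, h0 rfl]
        simp
      · obtain ⟨v, hv⟩ := Finsupp.ne_iff.1 ha
        have h := congrArg (coeff (a - Finsupp.single v 1)) (hdiv v (Finset.notMem_empty v) w)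
        rw [coeff_divVar, add_tsub_cancel_of_le] at h
        · simpa using h
        · rw [Finsupp.single_le_iff]
          exact Nat.one_le_iff_ne_zero.2 hv
    | succ i =>
      have h : c.curryLeft = 0 := by
        refine (Pi.basisFun K σ).ext fun v => ?_
        rw [Pi.basisFun_apply]
        exact hcurry v (Finset.notMem_empty v) i rfl
      ext1 w
      have h2 := congrArg (fun g => g (Matrix.vecHead w) (Matrix.vecTail w)) h
      simpa using h2
  | insert v S hv ih =>
    intro i c hc hdiv hcurry h0
    have hsub := sub_koszulDrop_eq v hc
    have hb : c - koszulDrop v c ∈ koszulBoundaries σ K _ i := by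
      rw [hsub]
      exact ⟨_, rfl⟩
    have hcyc : c - koszulDrop v c ∈ koszulCycles σ K _ i := by
      cases i with
      | zero => exact Submodule.mem_top
      | succ i =>
        rw [hsub]
        exact koszulD_koszulD i _
    rw [← sub_add_cancel c (koszulDrop v c)]
    refine Submodule.add_mem _ hb (ih _ ?_ ?_ ?_ ?_)
    · have := Submodule.sub_mem _ hc hcyc
      rwa [sub_sub_cancel] at this
    · intro u hu w
      by_cases huv : u = v
      · rw [huv]
        exact divVar_koszulDrop_self v c w
      · exact divVar_koszulDrop v (hdiv u (by simp [huv, hu])) w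
    · intro u hu k hk
      cases i with
      | zero => omega
      | succ i =>
      obtain rfl : i = k := by omega
      by_cases huv : u = v
      · rw [huv]
        exact curryLeft_koszulDrop_self v c
      · exact curryLeft_koszulDrop v (hcurry u (by simp [huv, hu]) i rfl)
    · rintro rfl w
      change coeff 0 (modVar K v (c w)) = 0
      rw [modVar_apply, coeff_sub, h0 rfl, coeff_X_mul']
      simp

/-- The Koszul complex of the polynomial ring is exact, except at the constants. -/
theorem koszulCycle_mem_boundaries {i : ℕ} {c : KoszulTerm σ K (MvPolynomial σ K) i}
    (hc : c ∈ koszulCycles σ K _ i) (h0 : i = 0 → ∀ w, coeff 0 (c w) = 0) :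
    c ∈ koszulBoundaries σ K _ i :=
  koszulCycle_mem_boundaries_aux Finset.univ c hc (fun v hv => absurd (Finset.mem_univ v) hv)
    (fun v hv => absurd (Finset.mem_univ v) hv) h0

end Koszul

/-! ### Regularity of R/I and of I -/

section Koszul

variable {σ K : Type*} [Fintype σ] [DecidableEq σ] [Field K]
  {M : Type*} [AddCommGroup M] [Module K M] [Module (MvPolynomial σ K) M]
  [IsScalarTower K (MvPolynomial σ K) M]

theorem hasRegularity_of_betti {ℳ : ℕ → Submodule K M} {i D : ℕ}
    (hne : gradedBetti σ ℳ i (i + D) ≠ 0)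
    (hvan : ∀ i j, D + i < j → gradedBetti σ ℳ i j = 0) : HasRegularity σ ℳ D := by
  refine ⟨⟨i, i + D, by push_cast; ring, hne⟩, ?_⟩
  rintro d ⟨i, j, rfl, h⟩
  by_contra hlt
  exact h (hvan i j (by omega))

theorem gradedBetti_ne_zero {ℳ : ℕ → Submodule K M} {i D : ℕ} {c : KoszulTerm σ K M i}
    (hc : c ∈ koszulCycles σ K M i) (hcD : ∀ w, c w ∈ ℳ D)
    (hcb : c ∉ koszulBoundaries σ K M i) : gradedBetti σ ℳ i (i + D) ≠ 0 := by
  rw [Ne, gradedBetti_eq_zero_iff]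
  intro h
  refine hcb (h c hc ((mem_koszulPiece (by omega)).2 ?_))
  rwa [Nat.add_sub_cancel_left]

theorem homogeneousComponent_X_mul (v : σ) (d : ℕ) (p : MvPolynomial σ K) :
    homogeneousComponent (d + 1) (X v * p) = X v * homogeneousComponent d p := by
  ext a
  rw [coeff_homogeneousComponent, coeff_X_mul', coeff_X_mul', coeff_homogeneousComponent]
  by_cases ha : v ∈ a.support
  · have h : Finsupp.single v 1 + (a - Finsupp.single v 1) = a := by
      refine add_tsub_cancel_of_le ?_
      rw [Finsupp.single_le_iff]
      exact Nat.one_le_iff_ne_zero.2 (Finsupp.mem_support_iff.1 ha)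
    have h2 : a.degree = 1 + (a - Finsupp.single v 1).degree := by
      conv_lhs => rw [← h, map_add, Finsupp.degree_single]
    rw [if_pos ha, if_pos ha, h2]
    exact if_congr (by omega) rfl rfl
  · rw [if_neg ha, if_neg ha, ite_self]

variable (I : Ideal (MvPolynomial σ K))

/-- The inclusion of an ideal, as a `K`-linear map. -/
def idealIncl : I →ₗ[K] MvPolynomial σ K := I.subtype.restrictScalars K

/-- The projection to the quotient by an ideal, as a `K`-linear map. -/
def idealProj : MvPolynomial σ K →ₗ[K] MvPolynomial σ K ⧸ I := (Ideal.Quotient.mkₐ K I).toLinearMap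

theorem idealProj_eq_zero {p : MvPolynomial σ K} : idealProj I p = 0 ↔ p ∈ I :=
  Ideal.Quotient.eq_zero_iff_mem

theorem idealProj_surjective : Function.Surjective (idealProj I) :=
  Ideal.Quotient.mk_surjective

theorem idealProj_X_mul (v : σ) (p : MvPolynomial σ K) :
    idealProj I (X v * p) = mulVar σ K _ v (idealProj I p) := rfl

theorem koszulD_idealIncl {i : ℕ} (c : KoszulTerm σ K I (i + 1)) :
    koszulD σ K _ i ((idealIncl I).compAlternatingMap c) =
      (idealIncl I).compAlternatingMap (koszulD σ K I i c) :=
  koszulD_compAlternatingMap _ (fun _ _ => rfl) i c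

theorem koszulD_idealProj {i : ℕ} (c : KoszulTerm σ K (MvPolynomial σ K) (i + 1)) :
    koszulD σ K _ i ((idealProj I).compAlternatingMap c) =
      (idealProj I).compAlternatingMap (koszulD σ K _ i c) :=
  koszulD_compAlternatingMap _ (fun _ _ => rfl) i c

theorem idealIncl_comp_injective {i : ℕ} {c c' : KoszulTerm σ K I i}
    (h : (idealIncl I).compAlternatingMap c = (idealIncl I).compAlternatingMap c') : c = c' := by
  ext1 w
  exact Subtype.ext (congrArg (fun f => f w) h)

/-- A chain whose image in the quotient vanishes comes from the ideal. -/
theorem exists_idealIncl_comp_eq {i : ℕ} (c : KoszulTerm σ K (MvPolynomial σ K) i)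
    (hc : (idealProj I).compAlternatingMap c = 0) :
    ∃ c' : KoszulTerm σ K I i, (idealIncl I).compAlternatingMap c' = c := by
  obtain ⟨c', -, h⟩ := exists_compAlternatingMap_eq (idealIncl I) ⊤ c fun w =>
    ⟨⟨c w, (idealProj_eq_zero I).1 (congrArg (fun f => f w) hc)⟩, trivial, rfl⟩
  exact ⟨c', h⟩

theorem idealProj_comp_idealIncl {i : ℕ} (c : KoszulTerm σ K I i) :
    (idealProj I).compAlternatingMap ((idealIncl I).compAlternatingMap c) = 0 := by
  ext1 w
  exact (idealProj_eq_zero I).2 (c w).2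

/-- Vanishing of the Betti numbers of `R ⧸ I` in a range implies that of the Betti numbers of `I`
in the shifted range. -/
theorem gradedBetti_idealPiece_eq_zero {i j : ℕ} (hij : i < j)
    (h : gradedBetti σ (quotientPiece I) (i + 1) j = 0) :
    gradedBetti σ (idealPiece I) i j = 0 := by
  rw [gradedBetti_eq_zero_iff] at h ⊢
  intro c hc hcp
  obtain ⟨d, rfl⟩ := Nat.exists_eq_add_of_lt hij
  rw [mem_koszulPiece (by omega), show i + d + 1 - i = d + 1 by omega] at hcp
  have hcp' : ∀ w, ((c w : I) : MvPolynomial σ K).IsHomogeneous (d + 1) := hcp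
  obtain ⟨b, hb⟩ : (idealIncl I).compAlternatingMap c ∈ koszulBoundaries σ K _ i := by
    refine koszulCycle_mem_boundaries ?_ ?_
    · cases i with
      | zero => exact Submodule.mem_top
      | succ i =>
        change koszulD σ K _ i c = 0 at hc
        change koszulD σ K _ i _ = 0
        rw [koszulD_idealIncl, hc]
        ext1 w
        rfl
    · intro _ w
      by_contra hne
      simpa using hcp' w hne
  -- The primitive b need not be homogeneous; its degree d part still bounds c because ∂ raises
  -- polynomial degree by one.
  let b' := (homogeneousComponent d).compAlternatingMap b
  have hb' : koszulD σ K _ i b' = (idealIncl I).compAlternatingMap c := by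
    ext1 w
    have h1 := congrArg (fun f => homogeneousComponent (d + 1) (f w)) hb
    simp only [koszulD_apply, map_sum, smul_eq_mul, homogeneousComponent_X_mul] at h1
    rw [koszulD_apply]
    exact h1.trans (homogeneousComponent_eq_self (hcp' w))
  obtain ⟨a, ha⟩ := h ((idealProj I).compAlternatingMap b')
    (by
      change koszulD σ K _ i _ = 0
      rw [koszulD_idealProj, hb', idealProj_comp_idealIncl])
    (by
      rw [mem_koszulPiece (by omega), show i + d + 1 - (i + 1) = d by omega]
      exact fun w => ⟨_, homogeneousComponent_mem _ _, rfl⟩)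
  obtain ⟨a', -, rfl⟩ := exists_compAlternatingMap_eq (idealProj I) ⊤ a fun w =>
    (idealProj_surjective I (a w)).imp fun _ hx => ⟨trivial, hx⟩
  -- Modulo I, b' is the boundary of a'; subtracting ∂a' moves the primitive into I without changing
  -- its boundary.
  obtain ⟨b₂, hb₂⟩ := exists_idealIncl_comp_eq I (b' - koszulD σ K _ (i + 1) a') (by
    have : (idealProj I).compAlternatingMap (b' - koszulD σ K _ (i + 1) a') =
        (idealProj I).compAlternatingMap b' -
          (idealProj I).compAlternatingMap (koszulD σ K _ (i + 1) a') := by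
      ext1 w
      simp
    rw [this, ← koszulD_idealProj, ha, sub_self])
  refine ⟨b₂, idealIncl_comp_injective I ?_⟩
  rw [← koszulD_idealIncl, hb₂, map_sub, koszulD_koszulD, sub_zero, hb']

/-- The connecting homomorphism `H_{i+1}(R ⧸ I) → H_i(I)` is injective. -/
theorem exists_idealCycle_notMem_boundaries {i D : ℕ} {c : KoszulTerm σ K (MvPolynomial σ K ⧸ I) (i + 1)}
    (hc : c ∈ koszulCycles σ K _ (i + 1)) (hcD : ∀ w, c w ∈ quotientPiece I D)
    (hcb : c ∉ koszulBoundaries σ K _ (i + 1)) :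
    ∃ z ∈ koszulCycles σ K I i, (∀ w, z w ∈ idealPiece I (D + 1)) ∧
      z ∉ koszulBoundaries σ K I i := by
  change koszulD σ K _ i c = 0 at hc
  obtain ⟨c', hc'D, rfl⟩ := exists_compAlternatingMap_eq (idealProj I) (homogeneousSubmodule σ K D)
    c hcD
  obtain ⟨z, hz⟩ := exists_idealIncl_comp_eq I (koszulD σ K _ i c')
    (by rw [← koszulD_idealProj, hc])
  refine ⟨z, ?_, fun w => ?_, ?_⟩
  · cases i with
    | zero => exact Submodule.mem_top
    | succ i =>
      refine idealIncl_comp_injective I ?_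
      rw [← koszulD_idealIncl, hz, koszulD_koszulD]
      ext1 w
      rfl
  · have h1 : ((z w : I) : MvPolynomial σ K) = koszulD σ K _ i c' w :=
      congrArg (fun f => f w) hz
    change ((z w : I) : MvPolynomial σ K).IsHomogeneous (D + 1)
    rw [h1, koszulD_apply]
    refine IsHomogeneous.sum _ _ _ fun v _ => ?_
    rw [add_comm D 1]
    exact (isHomogeneous_X K v).mul (hc'D _)
  · rintro ⟨b, rfl⟩
    -- A primitive b of z in I corrects the lift c' to a cycle over R in positive homological
    -- degree, hence a boundary; reducing mod I bounds c.
    obtain ⟨a, ha⟩ : c' - (idealIncl I).compAlternatingMap b ∈ koszulBoundaries σ K _ (i + 1) := by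
      refine koszulCycle_mem_boundaries ?_ (by simp)
      change koszulD σ K _ i _ = 0
      rw [map_sub, koszulD_idealIncl, hz, sub_self]
    refine hcb ⟨(idealProj I).compAlternatingMap a, ?_⟩
    rw [koszulD_idealProj, ha]
    ext1 w
    have h1 := congrArg (fun f => f w) (idealProj_comp_idealIncl I b)
    simp only [LinearMap.compAlternatingMap_apply, AlternatingMap.sub_apply, map_sub,
      AlternatingMap.zero_apply] at h1 ⊢
    rw [h1, sub_zero]

/-- The regularity of a one-dimensional Cohen-Macaulay quotient `R ⧸ I` and of `I`, for which the
variable `e` is a nonzerodivisor on `R ⧸ I`, in terms of the top degree of `R ⧸ (I, x_e)`. -/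
theorem regularity_of_mulVar_injective {e : σ}
    (hinj : ∀ p, X e * p ∈ I → p ∈ I) {D : ℕ}
    (hgen : ∀ d, D ≤ d → ∀ p ∈ homogeneousSubmodule σ K (d + 1),
      ∃ q ∈ homogeneousSubmodule σ K d, p - X e * q ∈ I)
    {f : MvPolynomial σ K} (hf : f.IsHomogeneous D) (hfe : ∀ q, f - X e * q ∉ I)
    (hbot : I = ⊥ → D = 0) (hne : I ≠ ⊥ → 2 ≤ Fintype.card σ) :
    IdealHasRegularity I (D + 1 : ℕ) ∧ HasRegularity σ (quotientPiece I) D := by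
  have hinj' : Function.Injective (mulVar σ K (MvPolynomial σ K ⧸ I) e) := by
    rw [injective_iff_map_eq_zero]
    intro m hm
    obtain ⟨p, rfl⟩ := idealProj_surjective I m
    rw [← idealProj_X_mul, idealProj_eq_zero] at hm
    exact (idealProj_eq_zero I).2 (hinj p hm)
  have hgen' : ∀ d, D ≤ d → ∀ m ∈ quotientPiece I (d + 1), ∃ m' ∈ quotientPiece I d,
      mulVar σ K (MvPolynomial σ K ⧸ I) e m' = m := by
    rintro d hd _ ⟨p, hp, rfl⟩
    obtain ⟨q, hq, hpq⟩ := hgen d hd p hp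
    refine ⟨idealProj I q, ⟨q, hq, rfl⟩, ?_⟩
    rw [← idealProj_X_mul]
    refine (sub_eq_zero.1 ?_).symm
    exact (map_sub (idealProj I) p (X e * q)).symm.trans ((idealProj_eq_zero I).2 hpq)
  have hmul : ∀ d v, ∀ m ∈ quotientPiece I d,
      mulVar σ K (MvPolynomial σ K ⧸ I) v m ∈ quotientPiece I (d + 1) := by
    rintro d v _ ⟨p, hp, rfl⟩
    refine ⟨X v * p, ?_, rfl⟩
    rw [add_comm]
    exact (isHomogeneous_X K v).mul hp
  have hvan : ∀ i j, D + i < j → gradedBetti σ (quotientPiece I) i j = 0 := fun i j hij =>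
    gradedBetti_eq_zero_of_lt hinj' hgen' hij
  obtain ⟨n, hn⟩ : ∃ n, Fintype.card σ = n + 1 :=
    Nat.exists_eq_succ_of_ne_zero (Fintype.card_pos_iff.2 ⟨e⟩).ne'
  obtain ⟨c, hc, hcD, hcb⟩ := exists_koszulCycle_notMem_boundaries (f := idealProj I f) hmul hinj'
    (hgen' D le_rfl) ⟨f, hf, rfl⟩ (fun m hm => by
      obtain ⟨q, rfl⟩ := idealProj_surjective I m
      refine hfe q ((idealProj_eq_zero I).1 ?_)
      rw [map_sub, ← hm, idealProj_X_mul, sub_self]) hn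
  refine ⟨?_, hasRegularity_of_betti (gradedBetti_ne_zero hc hcD hcb) hvan⟩
  by_cases hI : I = ⊥
  · exact Or.inr ⟨hI, by simp [hbot hI]⟩
  · refine Or.inl ⟨hI, ?_⟩
    -- The class for R/I sits in homological degree card σ - 1, which must be positive to be sent to
    -- I by the connecting map.
    obtain ⟨n, rfl⟩ : ∃ m, n = m + 1 := Nat.exists_eq_succ_of_ne_zero (by have := hne hI; omega)
    obtain ⟨z, hz, hzD, hzb⟩ := exists_idealCycle_notMem_boundaries I hc hcD hcb
    exact hasRegularity_of_betti (gradedBetti_ne_zero hz hzD hzb) fun i j hij =>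
      gradedBetti_idealPiece_eq_zero I (by omega) (hvan _ _ (by omega))

end Koszul

/-! ### Joins as minimum edge sets with prescribed parities -/

section Graph

variable {V : Type*}

open Classical in
/-- The parity vector of an edge. -/
def edgeVec (e : Sym2 V) : V → ZMod 2 := fun x => if x ∈ e then 1 else 0

/-- The parity vector of a finite set of edges: the parities of its vertex degrees. -/
def degParity (F : Finset (Sym2 V)) : V → ZMod 2 := ∑ e ∈ F, edgeVec e

open Classical in
theorem degParity_apply (F : Finset (Sym2 V)) (x : V) :
    degParity F x = ((F.filter fun e => x ∈ e).card : ℕ) := by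
  rw [degParity, Finset.sum_apply, Finset.card_filter, Nat.cast_sum]
  exact Finset.sum_congr rfl fun e _ => by simp [edgeVec]

theorem parity_add_self (x : V → ZMod 2) : x + x = 0 := by
  funext i
  exact CharTwo.add_self_eq_zero _

theorem degParity_symmDiff [DecidableEq V] (F F' : Finset (Sym2 V)) :
    degParity (symmDiff F F') = degParity F + degParity F' := by
  have h1 : degParity (symmDiff F F') = degParity (F \ F') + degParity (F' \ F) :=
    Finset.sum_union disjoint_sdiff_sdiff
  have h2 : degParity F = degParity (F \ F') + degParity (F ∩ F') := by
    rw [add_comm]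
    exact (Finset.sum_inter_add_sum_sdiff F F' _).symm
  have h3 : degParity F' = degParity (F' \ F) + degParity (F ∩ F') := by
    rw [add_comm, Finset.inter_comm]
    exact (Finset.sum_inter_add_sum_sdiff F' F _).symm
  rw [h1, h2, h3, add_add_add_comm, parity_add_self, add_zero]

theorem degParity_edges_eq_zero [DecidableEq V] {G : SimpleGraph V} {v : V} {C : G.Walk v v}
    (hC : C.IsTrail) : degParity C.edges.toFinset = 0 := by
  classical
  funext x
  have h := (hC.even_countP_edges_iff x).2 (fun h => absurd rfl h)
  rw [degParity_apply, Pi.zero_apply, ZMod.natCast_eq_zero_iff_even]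
  convert h using 1
  rw [List.countP_eq_length_filter, ← List.toFinset_card_of_nodup (hC.edges_nodup.filter _)]
  congr 1
  ext e
  simp

/-- A nonempty finite set of edges with even degrees contains the edges of a circuit. -/
theorem exists_circuit_of_degParity_eq_zero [DecidableEq V] {G : SimpleGraph V}
    {F : Finset (Sym2 V)} (hF : (F : Set (Sym2 V)) ⊆ G.edgeSet) (hne : F.Nonempty)
    (h0 : degParity F = 0) :
    ∃ (v : V) (C : G.Walk v v), C.IsCircuit ∧ C.edges.toFinset ⊆ F := by
  classical
  -- Without a circuit in F every trail in F is open. Its end then has odd degree in the trail but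
  -- even degree in F, so an unused edge prolongs it, eventually past length |F|.
  by_contra! hno
  have key : ∀ n : ℕ, ∃ (u v : V) (p : G.Walk u v), p.IsTrail ∧ p.edges.toFinset ⊆ F ∧
      p.length = n + 1 := by
    intro n
    induction n with
    | zero =>
      obtain ⟨e, he⟩ := hne
      induction e using Sym2.ind with
      | _ u v =>
        have huv : G.Adj u v := hF he
        exact ⟨u, v, huv.toWalk, by simp, by simpa using he, rfl⟩
    | succ n ih =>
      obtain ⟨u, v, p, hp, hpF, hlen⟩ := ih
      have huv : u ≠ v := by
        rintro rfl
        refine hno u p ⟨hp, ?_⟩ hpF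
        rintro rfl
        simp at hlen
      obtain ⟨e, heF, hve, hep⟩ : ∃ e ∈ F, v ∈ e ∧ e ∉ p.edges := by
        by_contra! hall
        have hodd := (hp.even_countP_edges_iff v).not.2 (by simp [huv])
        refine hodd ?_
        have hev := congrFun h0 v
        rw [degParity_apply, Pi.zero_apply, ZMod.natCast_eq_zero_iff_even] at hev
        convert hev using 1
        rw [List.countP_eq_length_filter, ← List.toFinset_card_of_nodup (hp.edges_nodup.filter _)]
        congr 1
        ext e
        simp only [List.mem_toFinset, List.mem_filter, decide_eq_true_eq, Finset.mem_filter]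
        exact ⟨fun h => ⟨hpF (List.mem_toFinset.2 h.1), h.2⟩, fun h => ⟨hall e h.1 h.2, h.2⟩⟩
      obtain ⟨w, rfl⟩ := hve
      have hvw : G.Adj v w := hF heF
      refine ⟨u, w, p.concat hvw, ?_, ?_, by simp [hlen]⟩
      · rw [SimpleGraph.Walk.isTrail_def, SimpleGraph.Walk.edges_concat, List.concat_eq_append,
          List.nodup_append]
        exact ⟨hp.edges_nodup, by simp, by
          intro a ha b hb
          rw [List.mem_singleton] at hb
          rintro rfl
          exact hep (hb ▸ ha)⟩
      · intro a ha
        simp only [SimpleGraph.Walk.edges_concat, List.concat_eq_append, List.mem_toFinset,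
          List.mem_append, List.mem_singleton] at ha
        rcases ha with ha | rfl
        · exact hpF (List.mem_toFinset.2 ha)
        · exact heF
  obtain ⟨u, v, p, hp, hpF, hlen⟩ := key F.card
  have h1 := Finset.card_le_card hpF
  rw [List.toFinset_card_of_nodup hp.edges_nodup, SimpleGraph.Walk.length_edges] at h1
  omega

variable [DecidableEq V] {G : SimpleGraph V}

theorem isJoin_coe_iff {J : Finset (Sym2 V)} :
    IsJoin G J ↔ (J : Set (Sym2 V)) ⊆ G.edgeSet ∧ ∀ (v : V) (C : G.Walk v v), C.IsCircuit →
      2 * (J ∩ C.edges.toFinset).card ≤ C.edges.toFinset.card := by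
  have h : ∀ {v : V} (C : G.Walk v v), C.edgeSet = (C.edges.toFinset : Set (Sym2 V)) := fun C => by
    ext e
    simp [SimpleGraph.Walk.edgeSet]
  simp only [IsJoin, h, ← Finset.coe_inter, Set.ncard_coe_finset]

/-- A join meets every set of edges with even degrees in at most half of its edges. -/
theorem IsJoin.two_mul_card_inter_le {J : Finset (Sym2 V)} (hJ : IsJoin G J)
    (F : Finset (Sym2 V)) (hF : (F : Set (Sym2 V)) ⊆ G.edgeSet) (h0 : degParity F = 0) :
    2 * (J ∩ F).card ≤ F.card := by
  induction F using Finset.strongInduction with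
  | _ F ih =>
    rcases F.eq_empty_or_nonempty with rfl | hne
    · simp
    obtain ⟨v, C, hC, hCF⟩ := exists_circuit_of_degParity_eq_zero hF hne h0
    have hCne : C.edges.toFinset.Nonempty := by
      rw [List.toFinset_nonempty_iff, Ne, SimpleGraph.Walk.edges_eq_nil]
      exact fun h => hC.ne_nil (SimpleGraph.Walk.eq_nil_iff_nil.2 h)
    -- Removing a circuit keeps all degrees even, so F is peeled off circuit by circuit.
    have hpar : degParity (F \ C.edges.toFinset) = 0 := by
      have h := degParity_symmDiff F C.edges.toFinset
      rwa [h0, degParity_edges_eq_zero hC.isTrail, add_zero, symmDiff_of_ge hCF] at h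
    have h1 := ih _ (Finset.sdiff_ssubset hCF hCne)
      (fun e he => hF (Finset.sdiff_subset he)) hpar
    have h2 := (isJoin_coe_iff.1 hJ).2 v C hC
    have h3 : (J ∩ F).card = (J ∩ (F \ C.edges.toFinset)).card + (J ∩ C.edges.toFinset).card := by
      rw [← Finset.card_union_of_disjoint, ← Finset.inter_union_distrib_left,
        Finset.sdiff_union_of_subset hCF]
      exact Finset.disjoint_of_subset_left Finset.inter_subset_right
        (Finset.disjoint_of_subset_right Finset.inter_subset_right Finset.sdiff_disjoint)
    have h4 := Finset.card_sdiff_add_card_eq_card hCF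
    omega

/-- A set of edges is a join if and only if it has minimum cardinality among the sets of edges with
the same parities of vertex degrees. -/
theorem isJoin_iff_forall_card_le {J : Finset (Sym2 V)} (hJ : (J : Set (Sym2 V)) ⊆ G.edgeSet) :
    IsJoin G J ↔ ∀ F : Finset (Sym2 V), (F : Set (Sym2 V)) ⊆ G.edgeSet →
      degParity F = degParity J → J.card ≤ F.card := by
  have hcard : ∀ A B : Finset (Sym2 V), (symmDiff A B).card = (A \ B).card + (B \ A).card :=
    fun A B => Finset.card_union_of_disjoint disjoint_sdiff_sdiff
  constructor
  · intro h F hF hpar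
    -- The even set J ∆ F meets J in J \ F, so the join inequality says |J \ F| ≤ |F \ J|.
    -- Conversely, minimality is tested on J ∆ E_C.
    have h1 := h.two_mul_card_inter_le (symmDiff J F)
      (fun e he => (Finset.mem_symmDiff.1 he).elim (fun h => hJ h.1) (fun h => hF h.1))
      (by rw [degParity_symmDiff, hpar, parity_add_self])
    have h2 : J ∩ symmDiff J F = J \ F := by
      ext e
      simp only [Finset.mem_inter, Finset.mem_symmDiff, Finset.mem_sdiff]
      tauto
    rw [h2, hcard] at h1
    have h3 := Finset.card_inter_add_card_sdiff J F
    have h4 := Finset.card_inter_add_card_sdiff F J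
    rw [Finset.inter_comm] at h4
    omega
  · intro h
    refine isJoin_coe_iff.2 ⟨hJ, fun v C hC => ?_⟩
    have h1 := h (symmDiff J C.edges.toFinset)
      (fun e he => (Finset.mem_symmDiff.1 he).elim (fun h => hJ h.1)
        (fun h => C.edges_subset_edgeSet (List.mem_toFinset.1 h.1)))
      (by rw [degParity_symmDiff, degParity_edges_eq_zero hC.isTrail, add_zero])
    rw [hcard] at h1
    have h3 := Finset.card_inter_add_card_sdiff J C.edges.toFinset
    have h4 := Finset.card_inter_add_card_sdiff C.edges.toFinset J
    rw [Finset.inter_comm] at h4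
    omega

end Graph

/-! ### Multisets of edges and the maximum vertex join number -/

section Graph

variable {V : Type*} {G : SimpleGraph V}

variable (G) in
/-- The parity vector of a multiset of edges. -/
def edgeParity : (G.edgeSet →₀ ℕ) →ₗ[ℕ] (V → ZMod 2) :=
  Finsupp.linearCombination ℕ fun e => edgeVec (e : Sym2 V)

@[simp]
theorem edgeParity_single (e : G.edgeSet) (n : ℕ) :
    edgeParity G (Finsupp.single e n) = n • edgeVec (e : Sym2 V) := by
  simp [edgeParity]

theorem edgeParity_single_two_mul (e : G.edgeSet) (n : ℕ) :
    edgeParity G (Finsupp.single e (2 * n)) = 0 := by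
  rw [edgeParity_single, mul_comm, mul_smul, two_smul, parity_add_self, smul_zero]

theorem edgeVec_mk [DecidableEq V] {i j : V} (h : i ≠ j) :
    edgeVec s(i, j) = Pi.single i 1 + Pi.single j 1 := by
  funext x
  simp only [edgeVec, Sym2.mem_iff, Pi.add_apply, Pi.single_apply]
  by_cases h1 : x = i
  · subst h1
    simp [h]
  · simp [h1]

/-- In a bipartite graph the parities of the vertex degrees determine the parity of the number of
edges. -/
theorem degree_mod_two_eq_of_edgeParity_eq [Fintype V] (hG : G.IsBipartite)
    {a b : G.edgeSet →₀ ℕ} (h : edgeParity G a = edgeParity G b) :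
    a.degree % 2 = b.degree % 2 := by
  classical
  obtain ⟨col⟩ := hG
  -- Sum of the parities over one colour class: each edge has exactly one end there, so the sum
  -- counts edges mod 2.
  let ℓ : (V → ZMod 2) →+ ZMod 2 :=
    ∑ x ∈ Finset.univ.filter fun x => col x = 0, Pi.evalAddMonoidHom (fun _ => ZMod 2) x
  have hℓ : ∀ e : G.edgeSet, ℓ (edgeVec (e : Sym2 V)) = 1 := by
    rintro ⟨e, he⟩
    induction e using Sym2.ind with
    | _ i j =>
      have hij : G.Adj i j := he
      have hc := col.valid hij
      have hs : ∀ i, ℓ (Pi.single i 1) = if col i = 0 then 1 else 0 := fun i => by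
        simp [ℓ, Pi.single_apply]
      rw [edgeVec_mk hij.ne, map_add, hs, hs]
      have h01 : ∀ x y : Fin 2, x ≠ y →
          (if x = 0 then 1 else 0) + (if y = 0 then 1 else 0) = (1 : ZMod 2) := by decide
      exact h01 _ _ hc
  have key : ∀ a : G.edgeSet →₀ ℕ, ℓ (edgeParity G a) = (a.degree : ZMod 2) := fun a => by
    induction a using Finsupp.induction_linear with
    | zero => simp
    | add a b ha hb => rw [map_add, map_add, ha, hb, map_add, Nat.cast_add]
    | single e n => rw [edgeParity_single, map_nsmul, hℓ, Finsupp.degree_single]; simp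
  have h1 := key a
  rw [h, key b] at h1
  exact ((ZMod.natCast_eq_natCast_iff' _ _ 2).1 h1).symm

/-- Multiplicities reduce mod 2 (sums become symmetric differences), so minimality among edge sets
passes to multisets. -/
theorem exists_finset_degParity_eq [DecidableEq V] (a : G.edgeSet →₀ ℕ) :
    ∃ F : Finset (Sym2 V), (F : Set (Sym2 V)) ⊆ G.edgeSet ∧ degParity F = edgeParity G a ∧
      F.card ≤ a.degree := by
  have hadd : ∀ a b : G.edgeSet →₀ ℕ,
      (∃ F : Finset (Sym2 V), (F : Set (Sym2 V)) ⊆ G.edgeSet ∧ degParity F = edgeParity G a ∧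
        F.card ≤ a.degree) →
      (∃ F : Finset (Sym2 V), (F : Set (Sym2 V)) ⊆ G.edgeSet ∧ degParity F = edgeParity G b ∧
        F.card ≤ b.degree) →
      ∃ F : Finset (Sym2 V), (F : Set (Sym2 V)) ⊆ G.edgeSet ∧
        degParity F = edgeParity G (a + b) ∧ F.card ≤ (a + b).degree := by
    rintro a b ⟨F, hF, hFa, hFc⟩ ⟨F', hF', hFb, hFc'⟩
    refine ⟨symmDiff F F', fun e he => (Finset.mem_symmDiff.1 he).elim (fun h => hF h.1)
      (fun h => hF' h.1), by rw [degParity_symmDiff, hFa, hFb, map_add], ?_⟩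
    rw [map_add]
    refine le_trans ?_ (Nat.add_le_add hFc hFc')
    exact (Finset.card_le_card Finset.symmDiff_subset_union).trans (Finset.card_union_le _ _)
  have hzero : ∃ F : Finset (Sym2 V), (F : Set (Sym2 V)) ⊆ G.edgeSet ∧
      degParity F = edgeParity G (0 : G.edgeSet →₀ ℕ) ∧ F.card ≤ (0 : G.edgeSet →₀ ℕ).degree :=
    ⟨∅, by simp, by simp [degParity], by simp⟩
  induction a using Finsupp.induction_linear with
  | zero => exact hzero
  | add a b ha hb => exact hadd a b ha hb
  | single e n =>
    induction n with
    | zero => rwa [Finsupp.single_zero]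
    | succ n ih =>
      rw [Finsupp.single_add]
      refine hadd _ _ ih ⟨{(e : Sym2 V)}, by simp, ?_, by simp⟩
      rw [edgeParity_single, one_smul]
      simp [degParity]

theorem exists_edgeParity_eq_degParity (F : Finset (Sym2 V))
    (hF : (F : Set (Sym2 V)) ⊆ G.edgeSet) :
    ∃ a : G.edgeSet →₀ ℕ, edgeParity G a = degParity F ∧ a.degree = F.card := by
  refine ⟨∑ e ∈ F.attach, Finsupp.single ⟨e, hF e.2⟩ 1, ?_, ?_⟩
  · simp only [map_sum, edgeParity_single, one_smul]
    exact Finset.sum_attach F edgeVec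
  · simp [map_sum]

theorem IsJoin.ncard_le_maxVertexJoinNumber [Finite V] {J : Set (Sym2 V)} (hJ : IsJoin G J) :
    J.ncard ≤ maxVertexJoinNumber G := by
  refine le_csSup ⟨Nat.card (Sym2 V), ?_⟩ ⟨J, hJ, rfl⟩
  rintro _ ⟨J, -, rfl⟩
  exact Set.ncard_le_card J

theorem exists_isJoin_ncard_eq (G : SimpleGraph V) [Finite V] :
    ∃ J : Set (Sym2 V), IsJoin G J ∧ J.ncard = maxVertexJoinNumber G := by
  refine Nat.sSup_mem (s := {n : ℕ | ∃ J : Set (Sym2 V), IsJoin G J ∧ J.ncard = n})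
    ⟨0, ∅, ⟨by simp, by simp⟩, by simp⟩ ⟨Nat.card (Sym2 V), ?_⟩
  rintro _ ⟨J, -, rfl⟩
  exact Set.ncard_le_card J

/-- A smallest edge set in the parity class of a is a join, hence has at most μ(G) edges. -/
theorem exists_edgeParity_eq_degree_le [Finite V] (a : G.edgeSet →₀ ℕ) :
    ∃ b, edgeParity G b = edgeParity G a ∧ b.degree ≤ maxVertexJoinNumber G := by
  classical
  let P : ℕ → Prop := fun n => ∃ F : Finset (Sym2 V), (F : Set (Sym2 V)) ⊆ G.edgeSet ∧
    degParity F = edgeParity G a ∧ F.card = n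
  have hP : ∃ n, P n := by
    obtain ⟨F, hF, hFa, -⟩ := exists_finset_degParity_eq a
    exact ⟨_, F, hF, hFa, rfl⟩
  obtain ⟨J, hJ, hJa, hJc⟩ := Nat.find_spec hP
  have hjoin : IsJoin G J := (isJoin_iff_forall_card_le hJ).2 fun F hF hFJ => by
    rw [hJc]
    exact Nat.find_min' hP ⟨F, hF, hFJ.trans hJa, rfl⟩
  obtain ⟨b, hb, hbc⟩ := exists_edgeParity_eq_degParity J hJ
  refine ⟨b, hb.trans hJa, ?_⟩
  rw [hbc, ← Set.ncard_coe_finset]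
  exact hjoin.ncard_le_maxVertexJoinNumber

theorem exists_degree_eq_maxVertexJoinNumber (G : SimpleGraph V) [Finite V] :
    ∃ b : G.edgeSet →₀ ℕ, b.degree = maxVertexJoinNumber G ∧
      ∀ a, edgeParity G a = edgeParity G b → maxVertexJoinNumber G ≤ a.degree := by
  classical
  obtain ⟨J, hJ, hJc⟩ := exists_isJoin_ncard_eq G
  obtain ⟨J, rfl⟩ := J.toFinite.exists_finset_coe
  rw [Set.ncard_coe_finset] at hJc
  obtain ⟨b, hb, hbc⟩ := exists_edgeParity_eq_degParity J hJ.1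
  refine ⟨b, hbc.trans hJc, fun a ha => ?_⟩
  obtain ⟨F, hF, hFa, hFc⟩ := exists_finset_degParity_eq a
  rw [← hJc]
  exact ((isJoin_iff_forall_card_le hJ.1).1 hJ F hF (by rw [hFa, ha, hb])).trans hFc

/-- Every multiset of at least `μ(G)` edges has the same parities as one containing `e`. -/
theorem exists_edgeParity_add_eq [Fintype V] (hG : G.IsBipartite) (e : G.edgeSet)
    {a : G.edgeSet →₀ ℕ} (ha : maxVertexJoinNumber G ≤ a.degree) :
    ∃ b : G.edgeSet →₀ ℕ, b.degree + 1 = a.degree ∧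
      edgeParity G (b + Finsupp.single e 1) = edgeParity G a := by
  obtain ⟨b, hb, hbd⟩ := exists_edgeParity_eq_degree_le (a + Finsupp.single e 1)
  have hmod := degree_mod_two_eq_of_edgeParity_eq hG hb
  rw [map_add, Finsupp.degree_single] at hmod
  -- The degree of b is at most μ(G) ≤ |a| and congruent to |a| + 1 mod 2, so it falls short of |a|
  -- - 1 by an even number, filled with copies of e.
  refine ⟨b + Finsupp.single e (2 * ((a.degree - 1 - b.degree) / 2)), ?_, ?_⟩
  · rw [map_add, Finsupp.degree_single]
    omega
  · rw [map_add, map_add, edgeParity_single_two_mul, hb, map_add, edgeParity_single, one_smul,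
      add_zero, add_assoc, parity_add_self, add_zero]

/-- There is a multiset of `μ(G) - 1` edges none of whose equivalents contains `e`. -/
theorem exists_forall_edgeParity_add_ne [Fintype V] (hG : G.IsBipartite) (e : G.edgeSet) :
    ∃ a : G.edgeSet →₀ ℕ, a.degree + 1 = maxVertexJoinNumber G ∧
      ∀ b, edgeParity G (b + Finsupp.single e 1) = edgeParity G a → b.degree + 1 ≠ a.degree := by
  obtain ⟨b₀, hb₀, hmin⟩ := exists_degree_eq_maxVertexJoinNumber G
  obtain ⟨b, hb, hbd⟩ := exists_edgeParity_eq_degree_le (b₀ + Finsupp.single e 1)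
  have hmod := degree_mod_two_eq_of_edgeParity_eq hG hb
  rw [map_add, Finsupp.degree_single] at hmod
  -- The witness represents a maximum join b₀ plus e, padded to size μ(G) - 1. Splitting off e would
  -- leave a multiset of size μ(G) - 2 in the class of b₀, against minimality.
  have hdeg : (b + Finsupp.single e (2 * ((b₀.degree - 1 - b.degree) / 2))).degree + 1 =
      maxVertexJoinNumber G := by
    rw [map_add, Finsupp.degree_single]
    omega
  refine ⟨_, hdeg, fun c hc => ?_⟩
  have h : edgeParity G c = edgeParity G b₀ := by
    rw [map_add, map_add, edgeParity_single_two_mul, hb, map_add, add_zero] at hc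
    exact add_right_cancel hc
  have := hmin c h
  omega

theorem maxVertexJoinNumber_le_one [Finite V] [Subsingleton G.edgeSet] :
    maxVertexJoinNumber G ≤ 1 := by
  obtain ⟨J, hJ, hJc⟩ := exists_isJoin_ncard_eq G
  rw [← hJc]
  exact Set.ncard_le_one_iff_subsingleton.2
    ((Set.subsingleton_coe _).1 ‹Subsingleton G.edgeSet› |>.anti hJ.1)

end Graph

/-! ### The ideals as kernels of monomial maps -/

section Graph

variable {V : Type*} {K : Type*} [Field K] {G : SimpleGraph V}

variable (V K) in
/-- The ideal `(x_i² - x_j² : i, j ∈ V)`. -/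
def squareIdeal : Ideal (MvPolynomial V K) :=
  Ideal.span {f : MvPolynomial V K | ∃ i j : V, f = X i ^ 2 - X j ^ 2}

/-- The parity vector of an exponent vector. -/
def expParity (a : V →₀ ℕ) : V → ZMod 2 := fun i => (a i : ZMod 2)

theorem expParity_add (a b : V →₀ ℕ) : expParity (a + b) = expParity a + expParity b := by
  funext i
  simp [expParity]

variable (K) in
open Classical in
/-- The homomorphism sending a monomial to its degree and its exponents modulo two. -/
def parityHom : MvPolynomial V K →ₐ[K] AddMonoidAlgebra K (ℕ × (V → ZMod 2)) :=
  aeval fun i => AddMonoidAlgebra.single (1, Pi.single i 1) 1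

theorem parityHom_monomial (a : V →₀ ℕ) (c : K) :
    parityHom K (monomial a c) = AddMonoidAlgebra.single (a.degree, expParity a) c := by
  classical
  have hmon : ∀ a : V →₀ ℕ, parityHom K (monomial a (1 : K)) =
      AddMonoidAlgebra.single (a.degree, expParity a) 1 := by
    intro a
    induction a using Finsupp.induction_linear with
    | zero =>
      rw [← C_apply, C_1, map_one, map_zero]
      rfl
    | add a b ha hb =>
      rw [← mul_one (1 : K), ← monomial_mul, map_mul, ha, hb, AddMonoidAlgebra.single_mul_single,
        map_add, expParity_add]
      rfl
    | single i n =>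
      rw [← X_pow_eq_monomial, map_pow, parityHom, aeval_X, AddMonoidAlgebra.single_pow, one_pow,
        Finsupp.degree_single]
      congr 1
      refine Prod.ext (by simp) (funext fun j => ?_)
      by_cases h : j = i
      · subst h
        simp [expParity]
      · simp [expParity, h]
  rw [← mul_one c, ← smul_eq_mul, ← smul_monomial, map_smul, hmon, AddMonoidAlgebra.smul_single]

/-- Normal form: all squares x_i² are identified with x_(i₀)², leaving a squarefree part. -/
theorem mk_monomial_eq [Fintype V] (i₀ : V) (a : V →₀ ℕ) :
    Ideal.Quotient.mk (squareIdeal V K) (monomial a 1) =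
      (∏ i, Ideal.Quotient.mk (squareIdeal V K) (X i) ^ (a i % 2)) *
        (Ideal.Quotient.mk (squareIdeal V K) (X i₀) ^ 2) ^ (∑ i, a i / 2) := by
  have hsq : ∀ i, Ideal.Quotient.mk (squareIdeal V K) (X i) ^ 2 =
      Ideal.Quotient.mk (squareIdeal V K) (X i₀) ^ 2 := fun i => by
    rw [← map_pow, ← map_pow, Ideal.Quotient.eq]
    exact Ideal.subset_span ⟨i, i₀, rfl⟩
  rw [monomial_eq, C_1, one_mul, Finsupp.prod_fintype _ _ fun i => pow_zero _, map_prod,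
    ← Finset.prod_pow_eq_pow_sum, ← Finset.prod_mul_distrib]
  refine Finset.prod_congr rfl fun i _ => ?_
  rw [map_pow, ← hsq i, ← pow_mul, ← pow_add, Nat.mod_add_div]

theorem mk_monomial_eq_of_parity_eq [Fintype V] {a b : V →₀ ℕ} (hd : a.degree = b.degree)
    (hp : expParity a = expParity b) :
    Ideal.Quotient.mk (squareIdeal V K) (monomial a 1) =
      Ideal.Quotient.mk (squareIdeal V K) (monomial b 1) := by
  rcases isEmpty_or_nonempty V with hV | ⟨⟨i₀⟩⟩
  · rw [Subsingleton.elim a b]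
  have hmod : ∀ i, a i % 2 = b i % 2 := fun i =>
    (ZMod.natCast_eq_natCast_iff' _ _ 2).1 (congrFun hp i)
  have hsum : ∀ a : V →₀ ℕ, a.degree = ∑ i, a i % 2 + 2 * ∑ i, a i / 2 := fun a => by
    rw [Finsupp.degree_eq_sum, Finset.mul_sum, ← Finset.sum_add_distrib]
    exact Finset.sum_congr rfl fun i _ => (Nat.mod_add_div _ _).symm
  rw [hsum a, hsum b, Finset.sum_congr rfl fun i _ => hmod i] at hd
  rw [mk_monomial_eq i₀, mk_monomial_eq i₀, Finset.prod_congr rfl fun i _ => by rw [hmod i],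
    show ∑ i, a i / 2 = ∑ i, b i / 2 by omega]

theorem mem_squareIdeal_iff [Fintype V] {p : MvPolynomial V K} :
    p ∈ squareIdeal V K ↔ parityHom K p = 0 := by
  classical
  constructor
  · intro hp
    suffices squareIdeal V K ≤ RingHom.ker (parityHom (V := V) K) from this hp
    refine Ideal.span_le.2 ?_
    rintro _ ⟨i, j, rfl⟩
    have h : ∀ i : V, parityHom K (X i ^ 2) = AddMonoidAlgebra.single (2, 0) (1 : K) := fun i => by
      rw [X_pow_eq_monomial, parityHom_monomial, Finsupp.degree_single]
      congr 2
      funext j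
      by_cases hij : i = j
      · subst hij
        simp only [expParity, Finsupp.single_eq_same]
        rfl
      · simp [expParity, hij]
    change parityHom K _ = 0
    rw [map_sub, h, h, sub_self]
  · intro hp
    -- The quotient map factors through `parityHom` by sending each pair to the class of any
    -- monomial realizing it; the value 0 at unrealized pairs plays no role.
    let rep : ℕ × (V → ZMod 2) → MvPolynomial V K ⧸ squareIdeal V K := fun s =>
      if h : ∃ a : V →₀ ℕ, (a.degree, expParity a) = s then
        Ideal.Quotient.mk _ (monomial h.choose 1) else 0
    have hrep : ∀ a : V →₀ ℕ, rep (a.degree, expParity a) =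
        Ideal.Quotient.mk _ (monomial a 1) := fun a => by
      have h : ∃ b : V →₀ ℕ, (b.degree, expParity b) = (a.degree, expParity a) := ⟨a, rfl⟩
      simp only [rep, dif_pos h]
      exact mk_monomial_eq_of_parity_eq (congrArg Prod.fst h.choose_spec)
        (congrArg Prod.snd h.choose_spec)
    have key : ∀ p : MvPolynomial V K,
        Finsupp.linearCombination K rep (parityHom K p).coeff = idealProj (squareIdeal V K) p := by
      intro p
      induction p using MvPolynomial.induction_on' with
      | monomial a c =>
        rw [parityHom_monomial, AddMonoidAlgebra.coeff_single, Finsupp.linearCombination_single,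
          hrep, ← mul_one c, ← smul_eq_mul, ← smul_monomial, map_smul, smul_eq_mul, mul_one]
        rfl
      | add p q hp hq => rw [map_add, AddMonoidAlgebra.coeff_add, map_add, hp, hq, map_add]
    rw [← idealProj_eq_zero, ← key, hp]
    simp

theorem parityHom_theta_monomial (a : G.edgeSet →₀ ℕ) (c : K) :
    parityHom K (theta K G (monomial a c)) =
      AddMonoidAlgebra.single (2 * a.degree, edgeParity G a) c := by
  classical
  have hX : ∀ e : G.edgeSet, parityHom K (theta K G (X e)) =
      AddMonoidAlgebra.single (2, edgeVec (e : Sym2 V)) 1 := by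
    rintro ⟨e, he⟩
    induction e using Sym2.ind with
    | _ i j =>
      have hij : G.Adj i j := he
      rw [theta, aeval_X, Sym2.lift_mk, map_mul, parityHom, aeval_X, aeval_X,
        AddMonoidAlgebra.single_mul_single, edgeVec_mk hij.ne, mul_one]
      rfl
  have hmon : ∀ a : G.edgeSet →₀ ℕ, parityHom K (theta K G (monomial a (1 : K))) =
      AddMonoidAlgebra.single (2 * a.degree, edgeParity G a) 1 := by
    intro a
    induction a using Finsupp.induction_linear with
    | zero =>
      rw [← C_apply, C_1, map_one, map_one, map_zero, map_zero]
      rfl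
    | add a b ha hb =>
      rw [← mul_one (1 : K), ← monomial_mul, map_mul, map_mul, ha, hb,
        AddMonoidAlgebra.single_mul_single, map_add, map_add, mul_add]
      rfl
    | single e n =>
      rw [← X_pow_eq_monomial, map_pow, map_pow, hX, AddMonoidAlgebra.single_pow, one_pow,
        Finsupp.degree_single, edgeParity_single, mul_comm]
      rfl
  rw [← mul_one c, ← smul_eq_mul, ← smul_monomial, map_smul, map_smul, hmon,
    AddMonoidAlgebra.smul_single]

theorem mem_graphIdeal_iff [Fintype V] {p : MvPolynomial G.edgeSet K} :
    p ∈ graphIdeal K G ↔ parityHom K (theta K G p) = 0 :=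
  (Ideal.mem_comap (f := theta K G)).trans mem_squareIdeal_iff

theorem monomial_sub_mem_graphIdeal [Fintype V] {a b : G.edgeSet →₀ ℕ} (c : K)
    (hd : a.degree = b.degree) (hp : edgeParity G a = edgeParity G b) :
    monomial a c - monomial b c ∈ graphIdeal K G := by
  rw [mem_graphIdeal_iff, map_sub, map_sub, parityHom_theta_monomial, parityHom_theta_monomial,
    hd, hp, sub_self]

theorem mem_graphIdeal_of_X_mul_mem [Fintype V] {e : G.edgeSet} {p : MvPolynomial G.edgeSet K}
    (h : X e * p ∈ graphIdeal K G) : p ∈ graphIdeal K G := by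
  rw [mem_graphIdeal_iff] at h ⊢
  rw [map_mul, map_mul, X, parityHom_theta_monomial] at h
  ext s
  have h1 := congrArg (fun q => q.coeff ((2 * (Finsupp.single e 1).degree,
    edgeParity G (Finsupp.single e 1)) + s)) h
  rwa [AddMonoidAlgebra.coeff_single_mul_eq_mul_coeff (m₂ := s)
    (H := fun _ _ => add_right_inj _), one_mul] at h1

/-- No monomial divisible by t_e is equivalent to t^a, so the class of t^a is absent from multiples
of t_e. This keeps t^a out of (I, t_e). -/
theorem coeff_parityHom_theta_X_mul {e : G.edgeSet} {a : G.edgeSet →₀ ℕ}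
    (ha : ∀ b, edgeParity G (b + Finsupp.single e 1) = edgeParity G a → b.degree + 1 ≠ a.degree)
    (q : MvPolynomial G.edgeSet K) :
    (parityHom K (theta K G (X e * q))).coeff (2 * a.degree, edgeParity G a) = 0 := by
  classical
  induction q using MvPolynomial.induction_on' with
  | monomial b c =>
    rw [X, monomial_mul, parityHom_theta_monomial, AddMonoidAlgebra.coeff_single, Finsupp.single_apply, if_neg]
    intro h
    rw [Prod.mk.injEq, add_comm, map_add, Finsupp.degree_single] at h
    exact ha b h.2 (by omega)
  | add p q hp hq =>
    rw [mul_add, map_add, map_add, AddMonoidAlgebra.coeff_add, Finsupp.add_apply, hp, hq, add_zero]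

theorem exists_homogeneous_sub_X_mul_mem [Fintype V] (hG : G.IsBipartite) (e : G.edgeSet) {d : ℕ}
    (hd : maxVertexJoinNumber G ≤ d + 1) {p : MvPolynomial G.edgeSet K}
    (hp : p.IsHomogeneous (d + 1)) :
    ∃ q : MvPolynomial G.edgeSet K, q.IsHomogeneous d ∧ p - X e * q ∈ graphIdeal K G := by
  have hex : ∀ a ∈ p.support, ∃ b : G.edgeSet →₀ ℕ, b.degree + 1 = a.degree ∧
      edgeParity G (b + Finsupp.single e 1) = edgeParity G a ∧ a.degree = d + 1 := fun a ha => by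
    have hdeg : a.degree = d + 1 := by
      rw [Finsupp.degree_eq_weight_one]
      exact hp (mem_support_iff.1 ha)
    obtain ⟨b, hb, hb'⟩ := exists_edgeParity_add_eq hG e (a := a) (by omega)
    exact ⟨b, hb, hb', hdeg⟩
  choose! b hb hb' hdeg using hex
  refine ⟨∑ a ∈ p.support, monomial (b a) (coeff a p), ?_, ?_⟩
  · refine IsHomogeneous.sum _ _ _ fun a ha => isHomogeneous_monomial _ ?_
    have := hb a ha
    have := hdeg a ha
    omega
  · conv =>
      enter [2, 1]
      rw [← support_sum_monomial_coeff p]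
    rw [Finset.mul_sum, ← Finset.sum_sub_distrib]
    refine Ideal.sum_mem _ fun a ha => ?_
    rw [X, monomial_mul, one_mul, add_comm]
    refine monomial_sub_mem_graphIdeal _ ?_ (hb' a ha).symm
    rw [map_add, Finsupp.degree_single, hb a ha]

theorem subsingleton_edgeSet_of_graphIdeal_eq_bot [Fintype V] (h : graphIdeal K G = ⊥) :
    Subsingleton G.edgeSet := by
  classical
  refine ⟨fun e f => ?_⟩
  -- Two distinct edges would give the nonzero element t_e² - t_f² of the ideal.
  have h1 : monomial (Finsupp.single e 2) 1 - monomial (Finsupp.single f 2) 1 ∈ graphIdeal K G :=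
    monomial_sub_mem_graphIdeal _ (by simp)
      ((edgeParity_single_two_mul e 1).trans (edgeParity_single_two_mul f 1).symm)
  rw [h, Ideal.mem_bot, sub_eq_zero, monomial_left_inj one_ne_zero] at h1
  exact ((Finsupp.single_eq_single_iff _ _ _ _).1 h1).elim (fun h => h.1) (by simp)

theorem graphIdeal_eq_bot_of_subsingleton [Fintype V] [Subsingleton G.edgeSet] :
    graphIdeal K G = ⊥ := by
  classical
  rw [eq_bot_iff]
  intro p hp
  rw [mem_graphIdeal_iff] at hp
  have hdeg : ∀ a b : G.edgeSet →₀ ℕ, a.degree = b.degree → a = b := fun a b hab => by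
    ext e
    have := uniqueOfSubsingleton e
    rw [Finsupp.degree_eq_sum, Finsupp.degree_eq_sum, Fintype.sum_subsingleton _ e,
      Fintype.sum_subsingleton _ e] at hab
    exact hab
  have key : ∀ (a : G.edgeSet →₀ ℕ) (p : MvPolynomial G.edgeSet K),
      (parityHom K (theta K G p)).coeff (2 * a.degree, edgeParity G a) = coeff a p := by
    intro a p
    induction p using MvPolynomial.induction_on' with
    | monomial b c =>
      rw [parityHom_theta_monomial, AddMonoidAlgebra.coeff_single, Finsupp.single_apply, coeff_monomial]
      refine if_congr ⟨fun h => hdeg _ _ ?_, fun h => by rw [h]⟩ rfl rfl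
      have := congrArg Prod.fst h
      dsimp only at this
      omega
    | add p q hp hq =>
      rw [map_add, map_add, AddMonoidAlgebra.coeff_add, Finsupp.add_apply, hp, hq, coeff_add]
  rw [Ideal.mem_bot]
  ext a
  rw [← key a p, hp]
  simp

end Graph

end JoinRegularity

end

theorem mainTheorem1 {V : Type*} [Fintype V] [DecidableEq V] [Nonempty V]
    (G : SimpleGraph V) [DecidableRel G.Adj] (hiso : ∀ v : V, ∃ w : V, G.Adj v w)
    (hbip : G.IsBipartite) (K : Type*) [Field K] :
    JoinRegularity.IdealHasRegularity (JoinRegularity.graphIdeal K G)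
        (JoinRegularity.maxVertexJoinNumber G : ℤ) ∧
      JoinRegularity.HasRegularity G.edgeSet
        (JoinRegularity.quotientPiece (JoinRegularity.graphIdeal K G))
        ((JoinRegularity.maxVertexJoinNumber G : ℤ) - 1) := by
  obtain ⟨v⟩ := ‹Nonempty V›
  obtain ⟨w, hvw⟩ := hiso v
  let e : G.edgeSet := ⟨s(v, w), hvw⟩
  obtain ⟨a, ha, hne⟩ := JoinRegularity.exists_forall_edgeParity_add_ne hbip e
  -- Here D = |a| = μ(G) - 1, and t^a is the element of top degree surviving in R/(I, t_e). The last
  -- two arguments settle the zero ideal, which occurs exactly when there is a single edge.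
  have h := JoinRegularity.regularity_of_mulVar_injective (JoinRegularity.graphIdeal K G) (e := e)
    (D := a.degree) (f := MvPolynomial.monomial a 1)
    (fun p => JoinRegularity.mem_graphIdeal_of_X_mul_mem)
    (fun d hd p hp => JoinRegularity.exists_homogeneous_sub_X_mul_mem hbip e (by omega) hp)
    (MvPolynomial.isHomogeneous_monomial _ rfl)
    (fun q hq => by
      rw [JoinRegularity.mem_graphIdeal_iff, map_sub, map_sub, sub_eq_zero] at hq
      have h1 := JoinRegularity.coeff_parityHom_theta_X_mul (K := K) hne q
      rw [← hq, JoinRegularity.parityHom_theta_monomial, AddMonoidAlgebra.coeff_single,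
        Finsupp.single_eq_same] at h1
      exact one_ne_zero h1)
    (fun hbot => by
      have := JoinRegularity.subsingleton_edgeSet_of_graphIdeal_eq_bot hbot
      have := JoinRegularity.maxVertexJoinNumber_le_one (G := G)
      omega)
    (fun hbot => by
      by_contra hlt
      have : Subsingleton G.edgeSet := Fintype.card_le_one_iff_subsingleton.1 (by omega)
      exact hbot JoinRegularity.graphIdeal_eq_bot_of_subsingleton)
  rw [ha] at h
  refine ⟨h.1, ?_⟩
  rw [← ha]
  simpa using h.2
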